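/- For a set $K\subset\mathbb R^n$ write $|K|$ for its Lebesgue measure. A closed bounded set $D\subset\mathbb R^n$ is a *star body* if the origin is an interior point of $D$, every line through the origin meets the boundary of $D$ in exactly two points different from the origin, and the Minkowski functional $\|x\|_D=\min\{a\ge 0: x\in aD\}$ is continuous on $\mathbb R^n$. For $n\ge 2$ let $\mathrm{Gr}_{n-1}$ be the Grassmannian of $(n-1)$-dimensional linear subspaces of $\mathbb R^n$. The class $\mathcal I_n$ of *intersection bodies* consists of the origin-symmetric star bodies $D$ in $\mathbb R^n$ for which there is a finite non-negative Borel measure $\nu_D$ on $\mathrm{Gr}_{n-1}$ such that, for every $g\in C(S^{n-1})$, $$\int_{S^{n-1}}\|x\|_D^{-1}\,g(x)\,dx=\int_{\mathrm{Gr}_{n-1}}\Big(\int_{S^{n-1}\cap H}g(x)\,dx\Big)\,d\nu_D(H),$$ where $dx$ denotes the surface measure on the respective sphere. The *outer volume ratio distance* from $K$ to $\mathcal I_n$ is $$d_{\rm ovr}(K,\mathcal I_n)=\inf\Big\{\Big(\frac{|D|}{|K|}\Big)^{1/n}:\ K\subset D,\ D\in\mathcal I_n\Big\}.$$ A compact set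 $K\subset\mathbb R^n$ with $|K|=1$ is *isotropic*, with *isotropic constant* $L_K\ge 0$, if $\int_K\langle x,\xi\rangle^2\,dx=L_K^2$ for every $\xi\in S^{n-1}$. **Theorem.** There is an absolute constant $C$ such that for every $n\ge 2$ and every origin-symmetric isotropic convex body $K$ in $\mathbb R^n$, $$L_K\le C\, d_{\rm ovr}(K,\mathcal I_n).$$ -/

import Mathlib

open MeasureTheory Metric
open scoped ENNReal NNReal

noncomputable section

/-- A star body in `ℝⁿ`: a closed bounded set with the origin in its interior, such that every
straight line through the origin meets the boundary in exactly two points different from the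
origin, and whose Minkowski functional is continuous. -/
structure IsStarBody {n : ℕ} (K : Set (EuclideanSpace ℝ (Fin n))) : Prop where
  isClosed : IsClosed K
  isBounded : Bornology.IsBounded K
  zero_mem_interior : 0 ∈ interior K
  ncard_boundary : ∀ v : EuclideanSpace ℝ (Fin n), v ≠ 0 →
    ((frontier K ∩ {x | ∃ t : ℝ, x = t • v}) \ {0}).ncard = 2
  continuous_gauge : Continuous (gauge K)

/-- The Grassmannian of linear subspaces of `ℝⁿ` of codimension `k`, i.e. of dimension `n - k`. -/
def GrassmannianCodim (n k : ℕ) : Type :=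
  {H : Submodule ℝ (EuclideanSpace ℝ (Fin n)) // Module.finrank ℝ H + k = n}

/-- The usual topology of the Grassmannian: subspaces are close if their orthogonal projections
are close in operator norm. -/
instance (n k : ℕ) : TopologicalSpace (GrassmannianCodim n k) :=
  TopologicalSpace.induced (fun H => H.1.starProjection) inferInstance

/-- The Borel `σ`-algebra of the Grassmannian. -/
instance (n k : ℕ) : MeasurableSpace (GrassmannianCodim n k) := borel _

instance (n k : ℕ) : BorelSpace (GrassmannianCodim n k) := ⟨rfl⟩

/-- The inclusion of the unit sphere of `H` in the unit sphere of `ℝⁿ`. -/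
def sphereIncl {n : ℕ} (H : Submodule ℝ (EuclideanSpace ℝ (Fin n)))
    (x : sphere (0 : H) 1) : sphere (0 : EuclideanSpace ℝ (Fin n)) 1 :=
  ⟨((x : H) : EuclideanSpace ℝ (Fin n)),
    mem_sphere_zero_iff_norm.2 (norm_eq_of_mem_sphere x)⟩

/-- The spherical Radon transform `g ↦ ∫_{S^{n-1} ∩ H} g(x) dx`; the integral is with respect to
the (non-normalized) surface measure of the unit sphere of `H`; here `volume` on `H` is the
`dim H`-dimensional Lebesgue measure of the Euclidean space `H`. -/
def sphericalRadon {n : ℕ} (g : C(sphere (0 : EuclideanSpace ℝ (Fin n)) 1, ℝ))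
    (H : Submodule ℝ (EuclideanSpace ℝ (Fin n))) : ℝ :=
  ∫ x : sphere (0 : H) 1, g (sphereIncl H x) ∂(volume : Measure H).toSphere

/-- The class of generalized `k`-intersection bodies in `ℝⁿ` (for `1 ≤ k ≤ n - 1`). -/
def generalizedIntersectionBodies (n k : ℕ) : Set (Set (EuclideanSpace ℝ (Fin n))) :=
  {D | IsStarBody D ∧ (∀ x ∈ D, -x ∈ D) ∧
    ∃ ν : Measure (GrassmannianCodim n k), IsFiniteMeasure ν ∧
      ∀ g : C(sphere (0 : EuclideanSpace ℝ (Fin n)) 1, ℝ),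
        ∫ x, (gauge D (x : EuclideanSpace ℝ (Fin n)))⁻¹ ^ k * g x
            ∂(volume : Measure (EuclideanSpace ℝ (Fin n))).toSphere
          = ∫ H, sphericalRadon g H.1 ∂ν}

/-- The class `I_n` of intersection bodies in `ℝⁿ` (for `n ≥ 2`). -/
def intersectionBodies (n : ℕ) : Set (Set (EuclideanSpace ℝ (Fin n))) :=
  generalizedIntersectionBodies n 1

/-- The outer volume ratio distance from `K` to a class `Ω` of bodies:
the infimum of `(|D| / |K|) ^ (1 / n)` over `D ∈ Ω` with `K ⊆ D`
(`⊤` if there is no such `D`). -/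
def outerVolumeRatioDist {n : ℕ} (K : Set (EuclideanSpace ℝ (Fin n)))
    (Ω : Set (Set (EuclideanSpace ℝ (Fin n)))) : ℝ≥0∞ :=
  ⨅ (D : Set (EuclideanSpace ℝ (Fin n))) (_ : D ∈ Ω) (_ : K ⊆ D),
    (volume D / volume K) ^ (1 / (n : ℝ))

/-- The compact set `K` has volume one and is in isotropic position, with isotropic constant
`L`. -/
structure IsIsotropicWith {n : ℕ} (K : Set (EuclideanSpace ℝ (Fin n))) (L : ℝ) : Prop where
  isCompact : IsCompact K
  volume_eq_one : volume K = 1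
  nonneg : 0 ≤ L
  integral_eq : ∀ ξ : EuclideanSpace ℝ (Fin n), ‖ξ‖ = 1 → ∫ x in K, (inner ℝ x ξ) ^ 2 = L ^ 2

end

/-! Let `K ⊆ D` with `D` an intersection body represented by `ν`, let `n = m + 1`, and let `ω`
denote volumes of unit balls. The representation of `D` is tested on two functions. With `g = ‖·‖_K
^ (-m)`, polar coordinates and `‖·‖_D ≤ ‖·‖_K` give `n = n|K| ≤ ∫ ‖x‖_D⁻¹ g = ∫ Rg dν`. Since `m =
dim H`, the Radon transform is a section volume, `Rg(H) = m |K ∩ H|`. In isotropic position every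
central hyperplane section satisfies `|K ∩ H| L ≤ 400`, hence `n L ≤ 400 m ν(Gr)`. With `g = 1`,
Hölder bounds the mass: `m ω_m ν(Gr) = ∫ ‖x‖_D⁻¹ ≤ n |D|^(1/n) ω_n^(1 - 1/n)`. As `ω_n^(1 - 1/n) ≤
ω_m`, the ball volumes cancel and `L ≤ 400 |D|^(1/n)`. The section bound is one-dimensional. By
Prékopa–Leindler, `f(t) = |K ∩ (H + tξ)|` is log-concave; it is also even, with integral `1` and
second moment `L²`. Such a density decays exponentially at scale `1 / f(0)`, so `f(0) L` is bounded
by an absolute constant. -/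

/-! ### Brunn–Minkowski on the line and Prékopa–Leindler -/

open scoped Pointwise in
/-- The Brunn–Minkowski inequality on the line, for compact sets. -/
theorem IsCompact.volume_add_volume_le_volume_add {A B : Set ℝ} (hA : IsCompact A)
    (hB : IsCompact B) (hA' : A.Nonempty) (hB' : B.Nonempty) :
    volume A + volume B ≤ volume (A + B) := by
  obtain ⟨a, ha⟩ := hA.exists_isGreatest hA'
  obtain ⟨b, hb⟩ := hB.exists_isLeast hB'
  -- With `a = max A` and `b = min B`, the translates `b + A` and `a + B` lie in `A + B` on either
  -- side of `a + b`.
  have hdisj : AEDisjoint volume (b +ᵥ A) (a +ᵥ B) := by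
    refine measure_mono_null (t := {a + b}) ?_ (measure_singleton _)
    rintro x ⟨⟨y, hy, rfl⟩, ⟨z, hz, hyz⟩⟩
    have h1 := ha.2 hy
    have h2 := hb.2 hz
    simp only [vadd_eq_add] at hyz ⊢
    simp only [Set.mem_singleton_iff]
    linarith
  calc volume A + volume B = volume (b +ᵥ A) + volume (a +ᵥ B) := by
        rw [measure_vadd, measure_vadd]
    _ = volume ((b +ᵥ A) ∪ (a +ᵥ B)) :=
        (measure_union₀ (hB.measurableSet.const_vadd a).nullMeasurableSet hdisj).symm
    _ ≤ volume (A + B) := by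
        refine measure_mono (Set.union_subset ?_ ?_)
        · rintro _ ⟨y, hy, rfl⟩
          exact ⟨y, hy, b, hb.1, add_comm _ _⟩
        · rintro _ ⟨y, hy, rfl⟩
          exact ⟨a, ha.1, y, hy, rfl⟩

open scoped Pointwise in
/-- The Brunn–Minkowski inequality on the line. -/
theorem MeasurableSet.volume_add_volume_le_volume_add {A B : Set ℝ} (hA : MeasurableSet A)
    (hB : MeasurableSet B) (hA' : A.Nonempty) (hB' : B.Nonempty) :
    volume A + volume B ≤ volume (A + B) := by
  obtain ⟨a, ha⟩ := hA'
  obtain ⟨b, hb⟩ := hB'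
  -- Inner regularity ranges over all compact subsets, including the empty one; inserting `a` and
  -- `b` makes them nonempty at no cost.
  have hcpt : ∀ A' ⊆ A, IsCompact A' → ∀ B' ⊆ B, IsCompact B' →
      volume A' + volume B' ≤ volume (A + B) := fun A' hA1 hA2 B' hB1 hB2 =>
    calc volume A' + volume B' ≤ volume (insert a A') + volume (insert b B') := by
          gcongr <;> exact Set.subset_insert _ _
      _ ≤ volume (insert a A' + insert b B') :=
          (hA2.insert a).volume_add_volume_le_volume_add (hB2.insert b) ⟨a, by simp⟩ ⟨b, by simp⟩
      _ ≤ volume (A + B) := by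
          gcongr
          · exact Set.insert_subset ha hA1
          · exact Set.insert_subset hb hB1
  have hleft : ∀ B' ⊆ B, IsCompact B' → volume A + volume B' ≤ volume (A + B) := by
    intro B' hB1 hB2
    refine add_le_of_le_tsub_right_of_le ?_ ?_
    · simpa using hcpt ∅ (Set.empty_subset _) isCompact_empty B' hB1 hB2
    · rw [hA.measure_eq_iSup_isCompact]
      exact iSup_le fun A' => iSup_le fun hA1 => iSup_le fun hA2 =>
        ENNReal.le_sub_of_add_le_right hB2.measure_lt_top.ne (hcpt A' hA1 hA2 B' hB1 hB2)
  have hle : volume A ≤ volume (A + B) := by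
    simpa using hleft ∅ (Set.empty_subset _) isCompact_empty
  by_cases htop : volume A = ∞
  · rw [htop, top_le_iff] at hle
    simp [hle]
  refine add_le_of_le_tsub_left_of_le hle ?_
  rw [hB.measure_eq_iSup_isCompact]
  exact iSup_le fun B' => iSup_le fun hB1 => iSup_le fun hB2 =>
    ENNReal.le_sub_of_add_le_left htop (hleft B' hB1 hB2)

theorem lintegral_eq_lintegral_meas_ofReal_lt {α : Type*} [MeasurableSpace α] (μ : Measure α)
    {u : α → ℝ≥0∞} (hu : Measurable u) (h1 : ∀ x, u x ≠ ∞) :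
    ∫⁻ x, u x ∂μ = ∫⁻ t in Set.Ioi (0 : ℝ), μ {x | ENNReal.ofReal t < u x} := by
  have := lintegral_eq_lintegral_meas_lt μ (f := fun x => (u x).toReal)
    (Filter.Eventually.of_forall fun x => ENNReal.toReal_nonneg) hu.ennreal_toReal.aemeasurable
  simp only [ENNReal.ofReal_toReal (h1 _)] at this
  rw [this]
  refine setLIntegral_congr_fun measurableSet_Ioi fun t ht => ?_
  congr 1
  ext x
  exact (ENNReal.ofReal_lt_iff_lt_toReal (le_of_lt ht) (h1 x)).symm

theorem ENNReal.geom_mean_le_arith_mean_two (a b : ℝ≥0∞) {p q : ℝ} (hp : 0 < p) (hq : 0 < q)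
    (hpq : p + q = 1) :
    a ^ p * b ^ q ≤ ENNReal.ofReal p * a + ENNReal.ofReal q * b := by
  by_cases ha : a = ∞
  · simp [ha, hp]
  by_cases hb : b = ∞
  · simp [hb, hq]
  lift a to ℝ≥0 using ha
  lift b to ℝ≥0 using hb
  have := NNReal.geom_mean_le_arith_mean2_weighted p.toNNReal q.toNNReal a b (by
    rw [← Real.toNNReal_add hp.le hq.le, hpq, Real.toNNReal_one])
  rw [Real.coe_toNNReal _ hp.le, Real.coe_toNNReal _ hq.le] at this
  rw [← ENNReal.coe_rpow_of_nonneg _ hp.le, ← ENNReal.coe_rpow_of_nonneg _ hq.le]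
  rw [ENNReal.ofReal, ENNReal.ofReal]
  exact_mod_cast this

theorem ENNReal.lt_rpow_mul_rpow {t a b : ℝ≥0∞} {p q : ℝ} (hp : 0 < p) (hq : 0 < q)
    (hpq : p + q = 1) (ha : t < a) (hb : t < b) : t < a ^ p * b ^ q := by
  have h : t ^ p * t ^ q = t := by
    rw [← ENNReal.rpow_add_of_nonneg _ _ hp.le hq.le, hpq, ENNReal.rpow_one]
  calc t = t ^ p * t ^ q := h.symm
    _ < a ^ p * b ^ q :=
      ENNReal.mul_lt_mul (ENNReal.rpow_lt_rpow ha hp) (ENNReal.rpow_lt_rpow hb hq)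

open scoped Pointwise in
/-- The additive form of the Prékopa–Leindler inequality on the line, for functions with
supremum one. -/
theorem add_lintegral_le_lintegral_of_rpow_mul_rpow_le {p q : ℝ} (hp : 0 < p) (hq : 0 < q)
    (hpq : p + q = 1) {f g h : ℝ → ℝ≥0∞} (hf : Measurable f) (hg : Measurable g)
    (hh : Measurable h) (hf1 : ∀ x, f x ≤ 1) (hg1 : ∀ x, g x ≤ 1)
    (hf2 : ∀ t < 1, ∃ x, t < f x) (hg2 : ∀ t < 1, ∃ x, t < g x)
    (H : ∀ x y, f x ^ p * g y ^ q ≤ h (p * x + q * y)) :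
    ENNReal.ofReal p * (∫⁻ x, f x) + ENNReal.ofReal q * (∫⁻ x, g x) ≤ ∫⁻ x, h x := by
  -- The layer-cake formula needs finite values. Truncation at `1` loses nothing, since only levels
  -- `t < 1` matter: there `p{f > t} + q{g > t} ⊆ {h > t}`.
  have hh' : Measurable fun x => min (h x) 1 := hh.min measurable_const
  refine le_trans ?_ (lintegral_mono (f := fun x => min (h x) 1) fun x => min_le_left _ _)
  rw [lintegral_eq_lintegral_meas_ofReal_lt _ hf fun x => ((hf1 x).trans_lt ENNReal.one_lt_top).ne,
    lintegral_eq_lintegral_meas_ofReal_lt _ hg fun x => ((hg1 x).trans_lt ENNReal.one_lt_top).ne,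
    lintegral_eq_lintegral_meas_ofReal_lt _ hh'
      fun x => ((min_le_right _ _).trans_lt ENNReal.one_lt_top).ne,
    ← lintegral_const_mul' _ _ ENNReal.ofReal_ne_top,
    ← lintegral_const_mul' _ _ ENNReal.ofReal_ne_top]
  refine (le_lintegral_add _ _).trans (setLIntegral_mono' measurableSet_Ioi fun t _ => ?_)
  by_cases ht : ENNReal.ofReal t < 1
  · have key := (MeasurableSet.const_smul₀ (measurableSet_lt measurable_const hf)
      p).volume_add_volume_le_volume_add
      (MeasurableSet.const_smul₀ (measurableSet_lt measurable_const hg) q)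
      (Set.Nonempty.smul_set (hf2 _ ht)) (Set.Nonempty.smul_set (hg2 _ ht))
    rw [Measure.addHaar_smul, Measure.addHaar_smul] at key
    simp only [Module.finrank_self, pow_one, abs_of_pos hp, abs_of_pos hq] at key
    refine key.trans (measure_mono ?_)
    rintro _ ⟨_, ⟨x, hx, rfl⟩, _, ⟨y, hy, rfl⟩, rfl⟩
    exact lt_min ((ENNReal.lt_rpow_mul_rpow hp hq hpq hx hy).trans_le (H x y)) ht
  · have h1 : {x | ENNReal.ofReal t < f x} = ∅ := by
      ext x; simpa using (hf1 x).trans (not_lt.1 ht)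
    have h2 : {x | ENNReal.ofReal t < g x} = ∅ := by
      ext x; simpa using (hg1 x).trans (not_lt.1 ht)
    simp [h1, h2]

/-- The Prékopa–Leindler inequality on the line, for bounded functions. -/
theorem prekopaLeindler_real_of_bounded {p q : ℝ} (hp : 0 < p) (hq : 0 < q)
    (hpq : p + q = 1) {f g h : ℝ → ℝ≥0∞} (hf : Measurable f) (hg : Measurable g)
    (hh : Measurable h) (hf1 : ⨆ x, f x ≠ ∞) (hg1 : ⨆ x, g x ≠ ∞)
    (H : ∀ x y, f x ^ p * g y ^ q ≤ h (p * x + q * y)) :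
    (∫⁻ x, f x) ^ p * (∫⁻ x, g x) ^ q ≤ ∫⁻ x, h x := by
  set a := ⨆ x, f x
  set b := ⨆ x, g x
  rcases eq_or_ne a 0 with ha0 | ha0
  · have : ∀ x, f x = 0 := fun x => le_antisymm ((le_iSup f x).trans ha0.le) zero_le
    simp [this, hp]
  rcases eq_or_ne b 0 with hb0 | hb0
  · have : ∀ x, g x = 0 := fun x => le_antisymm ((le_iSup g x).trans hb0.le) zero_le
    simp [this, hq]
  have hc0 : (a ^ p * b ^ q)⁻¹ ≠ ∞ := by
    simp [ha0, hb0, hf1, hg1]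
  have hc : (a ^ p * b ^ q) ≠ ∞ :=
    ENNReal.mul_ne_top (ENNReal.rpow_ne_top_of_nonneg hp.le hf1)
      (ENNReal.rpow_ne_top_of_nonneg hq.le hg1)
  have hcinv : (a ^ p * b ^ q)⁻¹ = (a⁻¹) ^ p * (b⁻¹) ^ q := by
    rw [ENNReal.mul_inv (Or.inr (ENNReal.rpow_ne_top_of_nonneg hq.le hg1))
      (Or.inl (ENNReal.rpow_ne_top_of_nonneg hp.le hf1)), ENNReal.inv_rpow, ENNReal.inv_rpow]
  have hsup : ∀ {u : ℝ → ℝ≥0∞}, (⨆ x, u x) ≠ 0 → (⨆ x, u x) ≠ ∞ →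
      ∀ t < 1, ∃ x, t < (⨆ x, u x)⁻¹ * u x := by
    intro u hu0 hu t ht
    have : t * (⨆ x, u x) < ⨆ x, u x := by
      conv_rhs => rw [← one_mul (⨆ x, u x)]
      exact (ENNReal.mul_lt_mul_iff_left hu0 hu).2 ht
    obtain ⟨x, hx⟩ := lt_iSup_iff.1 this
    refine ⟨x, ?_⟩
    rw [mul_comm, ← div_eq_mul_inv]
    exact (ENNReal.lt_div_iff_mul_lt (Or.inl hu0) (Or.inl hu)).2 hx
  have hle : ∀ {u : ℝ → ℝ≥0∞}, (⨆ x, u x) ≠ 0 → (⨆ x, u x) ≠ ∞ →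
      ∀ x, (⨆ x, u x)⁻¹ * u x ≤ 1 := by
    intro u hu0 hu x
    calc (⨆ x, u x)⁻¹ * u x ≤ (⨆ x, u x)⁻¹ * ⨆ x, u x := by gcongr; exact le_iSup u x
      _ = 1 := ENNReal.inv_mul_cancel hu0 hu
  -- Dividing by the suprema reduces to the additive form; the weighted arithmetic-geometric mean
  -- inequality then turns sums into products.
  have key := add_lintegral_le_lintegral_of_rpow_mul_rpow_le hp hq hpq
    (f := fun x => a⁻¹ * f x) (g := fun x => b⁻¹ * g x)
    (h := fun x => (a ^ p * b ^ q)⁻¹ * h x) (hf.const_mul _) (hg.const_mul _)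
    (hh.const_mul _) (hle ha0 hf1) (hle hb0 hg1) (hsup ha0 hf1) (hsup hb0 hg1) (by
      intro x y
      rw [ENNReal.mul_rpow_of_nonneg _ _ hp.le, ENNReal.mul_rpow_of_nonneg _ _ hq.le, hcinv,
        mul_mul_mul_comm]
      gcongr
      exact H x y)
  have key2 := (ENNReal.geom_mean_le_arith_mean_two _ _ hp hq hpq).trans key
  rw [lintegral_const_mul _ hf, lintegral_const_mul _ hg, lintegral_const_mul _ hh,
    ENNReal.mul_rpow_of_nonneg _ _ hp.le, ENNReal.mul_rpow_of_nonneg _ _ hq.le,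
    mul_mul_mul_comm, ← hcinv] at key2
  exact (ENNReal.mul_le_mul_iff_right (ENNReal.inv_ne_zero.2 hc) hc0).1 key2

/-- The Prékopa–Leindler inequality on the line. -/
theorem prekopaLeindler_real {p q : ℝ} (hp : 0 < p) (hq : 0 < q)
    (hpq : p + q = 1) {f g h : ℝ → ℝ≥0∞} (hf : Measurable f) (hg : Measurable g)
    (hh : Measurable h) (H : ∀ x y, f x ^ p * g y ^ q ≤ h (p * x + q * y)) :
    (∫⁻ x, f x) ^ p * (∫⁻ x, g x) ^ q ≤ ∫⁻ x, h x := by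
  have htr : ∀ {u : ℝ → ℝ≥0∞}, Measurable u →
      Filter.Tendsto (fun N : ℕ => ∫⁻ x, min (u x) N) Filter.atTop (nhds (∫⁻ x, u x)) := by
    intro u hu
    refine lintegral_tendsto_of_tendsto_of_monotone
      (fun N => (hu.min measurable_const).aemeasurable)
      (Filter.Eventually.of_forall fun x => ?_) (Filter.Eventually.of_forall fun x => ?_)
    · intro m n hmn
      exact min_le_min_left _ (by exact_mod_cast hmn)
    · have := (tendsto_const_nhds (x := u x)).min ENNReal.tendsto_nat_nhds_top
      simpa using this
  have hbd : ∀ {u : ℝ → ℝ≥0∞} (N : ℕ), ⨆ x, min (u x) N ≠ ∞ := fun N =>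
    ((iSup_le fun x => min_le_right _ _).trans_lt (ENNReal.natCast_lt_top N)).ne
  -- Excluding zero integrals avoids `0 * ∞`, where multiplication is discontinuous, when the
  -- truncations at `N` pass to the limit.
  by_cases hf0 : ∫⁻ x, f x = 0
  · simp [hf0, hp]
  by_cases hg0 : ∫⁻ x, g x = 0
  · simp [hg0, hq]
  refine le_of_tendsto (ENNReal.Tendsto.mul ((htr hf).ennrpow_const p) (Or.inl ?_)
    ((htr hg).ennrpow_const q) (Or.inl ?_)) (Filter.Eventually.of_forall fun N =>
      prekopaLeindler_real_of_bounded hp hq hpq (hf.min measurable_const) (hg.min measurable_const)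
        hh (hbd N) (hbd N) fun x y => le_trans ?_ (H x y))
  · simp [hf0, hp.not_gt]
  · simp [hg0, hq.not_gt]
  · gcongr <;> exact min_le_left _ _

theorem lintegral_fin_succ {m : ℕ} {u : (Fin (m + 1) → ℝ) → ℝ≥0∞} (hu : Measurable u) :
    ∫⁻ x, u x = ∫⁻ t : ℝ, ∫⁻ y : Fin m → ℝ, u (Fin.cons t y) := by
  have h := (volume_preserving_piFinSuccAbove (fun _ : Fin (m + 1) => ℝ) 0).symm
  rw [← h.lintegral_comp hu, Measure.volume_eq_prod]
  refine (lintegral_prod _ (hu.comp (MeasurableEquiv.piFinSuccAbove (fun _ : Fin (m + 1) => ℝ)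
      0).symm.measurable).aemeasurable).trans ?_
  simp [MeasurableEquiv.piFinSuccAbove, Fin.insertNthEquiv]

theorem measurable_fin_cons {m : ℕ} :
    Measurable fun z : ℝ × (Fin m → ℝ) => (Fin.cons z.1 z.2 : Fin (m + 1) → ℝ) := by
  refine measurable_pi_iff.2 fun i => ?_
  refine Fin.cases ?_ (fun j => ?_) i
  · simpa using measurable_fst
  · simpa using measurable_snd.eval (g := fun z : ℝ × (Fin m → ℝ) => z.2) (a := j)

/-- The Prékopa–Leindler inequality on `ℝᵐ`. -/
theorem prekopaLeindler_pi {p q : ℝ} (hp : 0 < p) (hq : 0 < q) (hpq : p + q = 1) {m : ℕ}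
    {f g h : (Fin m → ℝ) → ℝ≥0∞} (hf : Measurable f) (hg : Measurable g)
    (hh : Measurable h) (H : ∀ x y, f x ^ p * g y ^ q ≤ h (p • x + q • y)) :
    (∫⁻ x, f x) ^ p * (∫⁻ x, g x) ^ q ≤ ∫⁻ x, h x := by
  induction m with
  | zero =>
    simp only [lintegral_unique, volume_pi, Measure.pi_univ]
    simp only [Finset.univ_eq_empty, Finset.prod_empty, mul_one]
    convert H default default
  | succ m ih =>
    have hm : ∀ {u : (Fin (m + 1) → ℝ) → ℝ≥0∞}, Measurable u →
        Measurable fun t : ℝ => ∫⁻ y : Fin m → ℝ, u (Fin.cons t y) := fun hu =>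
      (hu.comp measurable_fin_cons).lintegral_prod_right'
    have hs : ∀ {u : (Fin (m + 1) → ℝ) → ℝ≥0∞}, Measurable u →
        ∀ t : ℝ, Measurable fun y : Fin m → ℝ => u (Fin.cons t y) := fun hu t =>
      hu.comp (measurable_fin_cons.comp measurable_prodMk_left)
    rw [lintegral_fin_succ hf, lintegral_fin_succ hg, lintegral_fin_succ hh]
    -- The induction hypothesis on slices is exactly the one-dimensional hypothesis for the slice
    -- integrals.
    refine prekopaLeindler_real hp hq hpq (hm hf) (hm hg) (hm hh) fun s t => ?_
    refine ih (hs hf s) (hs hg t) (hs hh _) fun x y => ?_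
    refine (H _ _).trans_eq (congrArg h ?_)
    ext i
    refine Fin.cases ?_ (fun j => ?_) i <;> simp

/-- The Prékopa–Leindler inequality on a Euclidean space. -/
theorem prekopaLeindler {E : Type*} [NormedAddCommGroup E] [InnerProductSpace ℝ E]
    [FiniteDimensional ℝ E] [MeasurableSpace E] [BorelSpace E] {p q : ℝ} (hp : 0 < p)
    (hq : 0 < q) (hpq : p + q = 1) {f g h : E → ℝ≥0∞} (hf : Measurable f) (hg : Measurable g)
    (hh : Measurable h) (H : ∀ x y, f x ^ p * g y ^ q ≤ h (p • x + q • y)) :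
    (∫⁻ x, f x) ^ p * (∫⁻ x, g x) ^ q ≤ ∫⁻ x, h x := by
  have hφ : MeasurePreserving fun x : Fin (Module.finrank ℝ E) → ℝ =>
      (stdOrthonormalBasis ℝ E).repr.symm (WithLp.toLp 2 x) :=
    (LinearIsometryEquiv.measurePreserving _).comp (PiLp.volume_preserving_toLp _)
  rw [← hφ.lintegral_comp hf, ← hφ.lintegral_comp hg, ← hφ.lintegral_comp hh]
  refine prekopaLeindler_pi hp hq hpq (hf.comp hφ.measurable) (hg.comp hφ.measurable)
    (hh.comp hφ.measurable) fun x y => (H _ _).trans_eq (congrArg h ?_)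
  simp [map_add, map_smul]

/-! ### Even log-concave densities on the line -/

theorem one_half_rpow_mul_sq_le {u : ℝ} (hu : 0 ≤ u) :
    u ^ 2 * (1 / 2 : ℝ) ^ u ≤ 392 * (1 + u ^ 2)⁻¹ := by
  have h1 : (1 / 2 : ℝ) ^ u ≤ Real.exp (-(u / 2)) := by
    rw [Real.rpow_def_of_pos (by norm_num), Real.exp_le_exp, one_div, Real.log_inv]
    nlinarith [Real.log_two_gt_d9]
  have h2 := Real.pow_div_factorial_le_exp (u / 2) (by positivity) 2
  have h4 := Real.pow_div_factorial_le_exp (u / 2) (by positivity) 4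
  norm_num [Nat.factorial] at h2 h4
  -- The Taylor terms give `u² ≤ 8 exp (u / 2)` and `u⁴ ≤ 384 exp (u / 2)`; their sum is the
  -- constant.
  have h5 : u ^ 2 * (1 + u ^ 2) ≤ 392 * Real.exp (u / 2) := by nlinarith
  rw [← div_eq_mul_inv, le_div_iff₀ (by positivity)]
  calc u ^ 2 * (1 / 2 : ℝ) ^ u * (1 + u ^ 2) ≤ u ^ 2 * Real.exp (-(u / 2)) * (1 + u ^ 2) := by
        gcongr
    _ = u ^ 2 * (1 + u ^ 2) * Real.exp (-(u / 2)) := by ring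
    _ ≤ 392 * Real.exp (u / 2) * Real.exp (-(u / 2)) := by gcongr
    _ = 392 := by rw [mul_assoc, ← Real.exp_add]; simp

/-- Values `a = f 0`, `b = f t` of a log-concave function with `f (q t) ≤ f 0 / 2`. -/
theorem le_mul_one_half_rpow {a b p q : ℝ} (ha : 0 < a) (hb : 0 ≤ b) (hq : 0 < q)
    (hpq : p + q = 1) (h : a ^ p * b ^ q ≤ a / 2) : b ≤ a * (1 / 2 : ℝ) ^ (1 / q) := by
  have h1 : (b / a) ^ q ≤ 1 / 2 := by
    rw [Real.div_rpow hb ha.le, div_le_iff₀ (by positivity)]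
    have h2 : a ^ p * a ^ q = a := by rw [← Real.rpow_add ha, hpq, Real.rpow_one]
    have h3 : a ^ p * b ^ q ≤ a ^ p * (1 / 2 * a ^ q) := by linarith
    exact le_of_mul_le_mul_left h3 (by positivity)
  have h2 := Real.rpow_le_rpow (by positivity) h1 (one_div_pos.2 hq).le
  rw [← Real.rpow_mul (by positivity), mul_one_div_cancel hq.ne', Real.rpow_one,
    div_le_iff₀ ha] at h2
  linarith

section LogConcave

variable {f : ℝ → ℝ≥0∞}

theorem LogConcave.le_apply_zero
    (hlog : ∀ p q : ℝ, 0 < p → 0 < q → p + q = 1 → ∀ s t, f s ^ p * f t ^ q ≤ f (p * s + q * t))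
    (heven : ∀ t, f (-t) = f t) (t : ℝ) : f t ≤ f 0 := by
  have h := hlog (1 / 2) (1 / 2) (by norm_num) (by norm_num) (by norm_num) (-t) t
  rw [heven, ← ENNReal.rpow_add_of_nonneg _ _ (by norm_num) (by norm_num)] at h
  norm_num at h
  exact h

/-- Otherwise log-concavity keeps `f ≥ M / 2` on all of `(0, 4 / M)`, which already carries mass
`2`. -/
theorem LogConcave.apply_le_half
    (hlog : ∀ p q : ℝ, 0 < p → 0 < q → p + q = 1 → ∀ s t, f s ^ p * f t ^ q ≤ f (p * s + q * t))
    (hint : ∫⁻ t, f t ≤ 1) {M : ℝ} (hM : 0 < M) (h0 : f 0 = ENNReal.ofReal M) :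
    f (4 / M) ≤ ENNReal.ofReal (M / 2) := by
  by_contra! hcon
  have hlt : ∀ s ∈ Set.Ioo (0 : ℝ) (4 / M), ENNReal.ofReal (M / 2) ≤ f s := by
    intro s hs
    have h4 : 0 < 4 / M := by positivity
    have hq : 0 < s / (4 / M) := div_pos hs.1 h4
    have hp : 0 < 1 - s / (4 / M) := by
      rw [sub_pos, div_lt_one h4]; exact hs.2
    have := hlog _ _ hp hq (by ring) 0 (4 / M)
    rw [mul_zero, zero_add, div_mul_cancel₀ _ h4.ne'] at this
    refine le_trans (ENNReal.lt_rpow_mul_rpow hp hq (by ring) ?_ hcon).le this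
    rw [h0]
    exact (ENNReal.ofReal_lt_ofReal_iff hM).2 (by linarith)
  have h2 : ENNReal.ofReal 2 ≤ 1 := by
    calc ENNReal.ofReal 2 = ENNReal.ofReal (M / 2) * volume (Set.Ioo (0 : ℝ) (4 / M)) := by
          rw [Real.volume_Ioo, ← ENNReal.ofReal_mul (by positivity)]
          congr 1
          field_simp
          norm_num
      _ = ∫⁻ _ in Set.Ioo (0 : ℝ) (4 / M), ENNReal.ofReal (M / 2) := by
          rw [setLIntegral_const]
      _ ≤ ∫⁻ t in Set.Ioo (0 : ℝ) (4 / M), f t := setLIntegral_mono' measurableSet_Ioo hlt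
      _ ≤ ∫⁻ t, f t := setLIntegral_le_lintegral _ _
      _ ≤ 1 := hint
  norm_num at h2

/-- Beyond `4 / M`, that point is a convex combination of `0` and `t`, so halving there propagates
geometrically to `t`. The factor `2` covers `|t| ≤ 4 / M`, where only `f ≤ f 0` is used. -/
theorem LogConcave.apply_le_exp
    (hlog : ∀ p q : ℝ, 0 < p → 0 < q → p + q = 1 → ∀ s t, f s ^ p * f t ^ q ≤ f (p * s + q * t))
    (heven : ∀ t, f (-t) = f t) (hint : ∫⁻ t, f t ≤ 1) {M : ℝ} (hM : 0 < M)
    (h0 : f 0 = ENNReal.ofReal M) (t : ℝ) :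
    f t ≤ ENNReal.ofReal (2 * M * (1 / 2 : ℝ) ^ (|t| / (4 / M))) := by
  wlog ht : 0 ≤ t generalizing t
  · rw [← heven, ← abs_neg]
    exact this (-t) (by linarith)
  have h4 : 0 < 4 / M := by positivity
  rw [abs_of_nonneg ht]
  rcases le_or_gt t (4 / M) with h | h
  · refine (LogConcave.le_apply_zero hlog heven t).trans ?_
    rw [h0]
    refine ENNReal.ofReal_le_ofReal ?_
    have : (1 / 2 : ℝ) ≤ (1 / 2 : ℝ) ^ (t / (4 / M)) := by
      conv_lhs => rw [← Real.rpow_one (1 / 2 : ℝ)]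
      exact Real.rpow_le_rpow_of_exponent_ge (by norm_num) (by norm_num) ((div_le_one h4).2 h)
    nlinarith
  · have ht0 : 0 < t := h4.trans h
    have hft : f t ≠ ∞ := ne_top_of_le_ne_top (by simp [h0]) (LogConcave.le_apply_zero hlog heven t)
    have hq : 0 < (4 / M) / t := div_pos h4 ht0
    have hp : 0 < 1 - (4 / M) / t := by rw [sub_pos, div_lt_one ht0]; exact h
    have h1 := (hlog _ _ hp hq (by ring) 0 t)
    rw [mul_zero, zero_add, div_mul_cancel₀ _ ht0.ne'] at h1
    have h2 := h1.trans (LogConcave.apply_le_half hlog hint hM h0)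
    rw [← ENNReal.ofReal_toReal hft, h0, ENNReal.ofReal_rpow_of_nonneg hM.le hp.le,
      ENNReal.ofReal_rpow_of_nonneg ENNReal.toReal_nonneg hq.le,
      ← ENNReal.ofReal_mul (by positivity), ENNReal.ofReal_le_ofReal_iff (by positivity)] at h2
    have h3 := le_mul_one_half_rpow hM ENNReal.toReal_nonneg hq (by ring) h2
    rw [one_div_div] at h3
    rw [← ENNReal.ofReal_toReal hft]
    refine ENNReal.ofReal_le_ofReal (h3.trans ?_)
    have : 0 ≤ (1 / 2 : ℝ) ^ (t / (4 / M)) := by positivity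
    nlinarith

/-- An even log-concave density on the line satisfies `f 0 ^ 2 * ∫ t ^ 2 f(t) dt ≤ 400 ^ 2`. -/
theorem LogConcave.lintegral_sq_mul_le
    (hlog : ∀ p q : ℝ, 0 < p → 0 < q → p + q = 1 → ∀ s t, f s ^ p * f t ^ q ≤ f (p * s + q * t))
    (heven : ∀ t, f (-t) = f t) (hint : ∫⁻ t, f t ≤ 1) {M : ℝ} (hM : 0 < M)
    (h0 : f 0 = ENNReal.ofReal M) :
    ∫⁻ t, ENNReal.ofReal (t ^ 2) * f t ≤ ENNReal.ofReal ((400 / M) ^ 2) := by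
  have h4 : 0 < 4 / M := by positivity
  have hpt : ∀ t, ENNReal.ofReal (t ^ 2) * f t ≤
      ENNReal.ofReal (784 * 16 / M * (1 + (t / (4 / M)) ^ 2)⁻¹) := by
    intro t
    refine (mul_le_mul_right (LogConcave.apply_le_exp hlog heven hint hM h0 t) _).trans ?_
    rw [← ENNReal.ofReal_mul (by positivity)]
    refine ENNReal.ofReal_le_ofReal ?_
    have h := one_half_rpow_mul_sq_le (u := |t| / (4 / M)) (by positivity)
    rw [div_pow, sq_abs, ← div_pow] at h
    calc t ^ 2 * (2 * M * (1 / 2 : ℝ) ^ (|t| / (4 / M)))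
        = 32 / M * ((t / (4 / M)) ^ 2 * (1 / 2 : ℝ) ^ (|t| / (4 / M))) := by
          field_simp
          ring
      _ ≤ 32 / M * (392 * (1 + (t / (4 / M)) ^ 2)⁻¹) := by gcongr
      _ = _ := by ring
  refine (lintegral_mono hpt).trans ?_
  have hi : Integrable fun t : ℝ => 784 * 16 / M * (1 + (t / (4 / M)) ^ 2)⁻¹ :=
    (integrable_inv_one_add_sq.comp_div h4.ne').const_mul _
  rw [← ofReal_integral_eq_lintegral_ofReal hi
    (Filter.Eventually.of_forall fun t => by positivity)]
  refine ENNReal.ofReal_le_ofReal ?_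
  rw [integral_const_mul, Measure.integral_comp_div (fun x : ℝ => (1 + x ^ 2)⁻¹),
    integral_univ_inv_one_add_sq, abs_of_pos h4, smul_eq_mul]
  -- The constant `400` comes from `50176 π < 400²`.
  have : 784 * 16 / M * (4 / M * Real.pi) = 50176 * Real.pi / M ^ 2 := by
    field_simp
    ring
  rw [this, div_pow]
  gcongr
  linarith [Real.pi_lt_d2]

end LogConcave

/-! ### Hyperplane sections of isotropic bodies -/

section Section

variable {E : Type*} [NormedAddCommGroup E] [InnerProductSpace ℝ E] [FiniteDimensional ℝ E]
  [MeasurableSpace E] [BorelSpace E] {H : Submodule ℝ E} {ξ : E}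

theorem measurePreserving_smul_add (hξ : ‖ξ‖ = 1) (hH : ξ ∈ Hᗮ)
    (hd : Module.finrank ℝ H + 1 = Module.finrank ℝ E) :
    MeasurePreserving fun z : ℝ × H => z.1 • ξ + (z.2 : E) := by
  let φ : WithLp 2 (ℝ × H) →ₗᵢ[ℝ] E :=
    { toFun := fun z => z.fst • ξ + (z.snd : E)
      map_add' := fun x y => by
        simp only [WithLp.add_fst, WithLp.add_snd, add_smul, Submodule.coe_add]; abel
      map_smul' := fun c x => by
        simp [mul_smul]
      norm_map' := fun z => by
        have h : inner ℝ (z.fst • ξ) (z.snd : E) = 0 := by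
          rw [inner_smul_left, (Submodule.mem_orthogonal' _ _).1 hH _ z.snd.2, mul_zero]
        have h1 := norm_add_sq_eq_norm_sq_add_norm_sq_of_inner_eq_zero _ _ h
        have h2 := WithLp.prod_norm_sq_eq_of_L2 z
        rw [norm_smul, hξ, mul_one] at h1
        refine (sq_eq_sq₀ (norm_nonneg _) (norm_nonneg _)).1 ?_
        change ‖z.fst • ξ + (z.snd : E)‖ ^ 2 = _
        rw [h2, sq, h1, sq, sq, Submodule.coe_norm] }
  have hfin : Module.finrank ℝ (WithLp 2 (ℝ × H)) = Module.finrank ℝ E := by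
    rw [(WithLp.linearEquiv 2 ℝ (ℝ × H)).finrank_eq, Module.finrank_prod, Module.finrank_self,
      ← hd, add_comm]
  exact (φ.toLinearIsometryEquiv hfin).measurePreserving.comp (WithLp.volume_preserving_toLp ℝ H)

variable {K : Set E}

/-- The hyperplane sections of a symmetric convex body of volume one. -/
theorem volume_section_mul_le (hξ : ‖ξ‖ = 1) (hH : ξ ∈ Hᗮ)
    (hd : Module.finrank ℝ H + 1 = Module.finrank ℝ E) (hK : Convex ℝ K) (hc : IsCompact K)
    (hsymm : ∀ x ∈ K, -x ∈ K) (hvol : volume K = 1) {L : ℝ} (hL : 0 ≤ L)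
    (hLK : ∫ x in K, (inner ℝ x ξ) ^ 2 = L ^ 2) :
    (volume {y : H | (y : E) ∈ K}).toReal * L ≤ 400 := by
  have hφ := measurePreserving_smul_add hξ hH hd
  have hKm : MeasurableSet K := hc.measurableSet
  set S : ℝ → Set H := fun t => {y : H | t • ξ + (y : E) ∈ K} with hS
  have hSm : ∀ t, MeasurableSet (S t) := fun t =>
    (hφ.measurable.comp measurable_prodMk_left) hKm
  set f : ℝ → ℝ≥0∞ := fun t => volume (S t) with hf
  have hind : ∀ t, f t = ∫⁻ y, (S t).indicator 1 y := fun t => (lintegral_indicator_one (hSm t)).symm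
  -- Prékopa–Leindler for indicators of slices; its hypothesis is the convexity of `K`.
  have hlog : ∀ p q : ℝ, 0 < p → 0 < q → p + q = 1 →
      ∀ s t, f s ^ p * f t ^ q ≤ f (p * s + q * t) := by
    intro p q hp hq hpq s t
    rw [hind, hind, hind]
    refine prekopaLeindler hp hq hpq (measurable_one.indicator (hSm _))
      (measurable_one.indicator (hSm _)) (measurable_one.indicator (hSm _)) fun x y => ?_
    by_cases hx : x ∈ S s
    · by_cases hy : y ∈ S t
      · have : p • x + q • y ∈ S (p * s + q * t) := by
          have := hK hx hy hp.le hq.le hpq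
          have e : p • (s • ξ + (x : E)) + q • (t • ξ + (y : E)) =
              (p * s + q * t) • ξ + ((p • x + q • y : H) : E) := by
            simp only [smul_add, add_smul, mul_smul, Submodule.coe_add, Submodule.coe_smul]; abel
          rw [e] at this
          exact this
        simp [hx, hy, this]
      · simp [hy, hq]
    · simp [hx, hp]
  have heven : ∀ t, f (-t) = f t := by
    intro t
    have : S (-t) = -S t := by
      ext y
      simp only [hS, Set.mem_neg, Set.mem_ofPred_eq]
      constructor
      · intro h; have := hsymm _ h; simpa [neg_add_rev, add_comm] using this
      · intro h; have := hsymm _ h; simpa [neg_add_rev, add_comm] using this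
    simp only [hf, this, Measure.measure_neg]
  -- By Fubini, `f` is the density of `⟨x, ξ⟩` on `K`; `u = 1` and `u = t²` give the mass and the
  -- second moment.
  have hmap : ∀ u : ℝ → ℝ≥0∞, Measurable u →
      ∫⁻ x in K, u (inner ℝ x ξ) = ∫⁻ t, u t * f t := by
    intro u hu
    have hin : Measurable fun x : E => u (inner ℝ x ξ) := by fun_prop
    rw [← lintegral_indicator hKm, ← hφ.lintegral_comp (hin.indicator hKm),
      Measure.volume_eq_prod]
    refine (lintegral_prod _ ((hin.indicator hKm).comp hφ.measurable).aemeasurable).trans ?_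
    refine lintegral_congr fun t => ?_
    rw [hind, ← lintegral_const_mul _ (measurable_one.indicator (hSm t))]
    refine lintegral_congr fun y => ?_
    have e : inner ℝ (t • ξ + (y : E)) ξ = t := by
      rw [inner_add_left, inner_smul_left, real_inner_self_eq_norm_sq, hξ,
        (Submodule.mem_orthogonal _ _).1 hH _ y.2]
      simp
    by_cases hy : t • ξ + (y : E) ∈ K
    · have hy' : y ∈ S t := hy
      simp [hy, hy', e]
    · have hy' : y ∉ S t := hy
      simp [hy, hy']
  have hint : ∫⁻ t, f t ≤ 1 := by
    have := hmap 1 measurable_one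
    simp only [Pi.one_apply, one_mul, setLIntegral_one, hvol] at this
    exact this.ge
  have hmom : ∫⁻ t, ENNReal.ofReal (t ^ 2) * f t = ENNReal.ofReal (L ^ 2) := by
    rw [← hmap (fun t => ENNReal.ofReal (t ^ 2)) (by fun_prop), ← hLK]
    refine (ofReal_integral_eq_lintegral_ofReal ?_
      (Filter.Eventually.of_forall fun x => sq_nonneg _)).symm
    exact (Continuous.continuousOn (by fun_prop)).integrableOn_compact hc
  have hSeq : {y : H | (y : E) ∈ K} = S 0 := by
    ext y; simp [hS]
  have hfin : f 0 ≠ ∞ := by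
    refine (IsCompact.measure_lt_top ?_).ne
    rw [← hSeq]
    exact (Submodule.closed_of_finiteDimensional H).isClosedEmbedding_subtypeVal.isCompact_preimage hc
  rw [hSeq]
  change (f 0).toReal * L ≤ 400
  rcases eq_or_ne (f 0) 0 with h0 | h0
  · simp [h0]
  · have hM : 0 < (f 0).toReal := ENNReal.toReal_pos h0 hfin
    have := LogConcave.lintegral_sq_mul_le hlog heven hint hM (ENNReal.ofReal_toReal hfin).symm
    rw [hmom, ENNReal.ofReal_le_ofReal_iff (by positivity)] at this
    have h2 := (sq_le_sq₀ hL (by positivity)).1 this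
    rwa [le_div_iff₀ hM, mul_comm] at h2

end Section

/-! ### Volume in polar coordinates -/

section Polar

variable {E : Type*} [NormedAddCommGroup E] [NormedSpace ℝ E] [FiniteDimensional ℝ E]
  [Nontrivial E] [MeasurableSpace E] [BorelSpace E] (μ : Measure E) [μ.IsAddHaarMeasure]

/-- The volume of `{φ < 1}` in polar coordinates, for a positively homogeneous function `φ`. -/
theorem measure_lt_one_eq_lintegral_toSphere {φ : E → ℝ} (hφ : Measurable φ)
    (hhom : ∀ r : ℝ, 0 < r → ∀ x, φ (r • x) = r * φ x) (hpos : ∀ x ∈ sphere (0 : E) 1, 0 < φ x) :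
    μ {x | φ x < 1} = ∫⁻ x : sphere (0 : E) 1,
      ENNReal.ofReal ((φ x)⁻¹ ^ Module.finrank ℝ E / Module.finrank ℝ E) ∂μ.toSphere := by
  have hd : 0 < Module.finrank ℝ E := Module.finrank_pos
  set T : Set (sphere (0 : E) 1 × Set.Ioi (0 : ℝ)) := {z | z.2.1 * φ z.1 < 1} with hT
  have hTm : MeasurableSet T := by
    refine measurableSet_lt ?_ measurable_const
    exact (measurable_subtype_coe.comp measurable_snd).mul
      (hφ.comp (measurable_subtype_coe.comp measurable_fst))
  have hpre : (homeomorphUnitSphereProd E) ⁻¹' T = Subtype.val ⁻¹' {x | φ x < 1} := by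
    ext x
    have hx : 0 < ‖(x : E)‖ := norm_pos_iff.2 x.2
    simp only [hT, Set.mem_preimage, Set.mem_ofPred_eq]
    rw [homeomorphUnitSphereProd_apply_snd_coe, ← hhom _ hx,
      homeomorphUnitSphereProd_apply_fst_coe, smul_smul, mul_inv_cancel₀ hx.ne', one_smul]
  have h1 : μ {x | φ x < 1} = (μ.comap (Subtype.val : ({0}ᶜ : Set E) → E))
      ((homeomorphUnitSphereProd E) ⁻¹' T) := by
    rw [hpre, comap_subtype_coe_apply (measurableSet_singleton _).compl,
      Subtype.image_preimage_coe, Set.inter_comm, ← Set.sdiff_eq,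
      measure_sdiff_null (measure_singleton _)]
  rw [h1, μ.measurePreserving_homeomorphUnitSphereProd.measure_preimage hTm.nullMeasurableSet,
    Measure.prod_apply hTm]
  refine lintegral_congr fun x => ?_
  have hx := hpos _ x.2
  -- In direction `x` the set is the radial interval `(0, 1 / φ x)`, whose mass under `r ^ (d - 1)
  -- dr` is `(φ x)⁻¹ ^ d / d`.
  have h2 : Prod.mk x ⁻¹' T = Set.Iio (⟨(φ x)⁻¹, inv_pos.2 hx⟩ : Set.Ioi (0 : ℝ)) := by
    ext r
    simp only [hT, Set.mem_preimage, Set.mem_ofPred_eq, Set.mem_Iio]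
    rw [← Subtype.coe_lt_coe, lt_inv_comm₀ r.2 hx, lt_inv_comm₀ hx r.2, ← one_div,
      lt_div_iff₀ hx]
  rw [h2, Measure.volumeIoiPow_apply_Iio, Nat.sub_add_cancel hd, Nat.cast_pred hd,
    sub_add_cancel]

theorem integral_toSphere_inv_pow {φ : E → ℝ} (hφ : Measurable φ)
    (hhom : ∀ r : ℝ, 0 < r → ∀ x, φ (r • x) = r * φ x) (hpos : ∀ x ∈ sphere (0 : E) 1, 0 < φ x) :
    ∫ x : sphere (0 : E) 1, (φ x)⁻¹ ^ Module.finrank ℝ E ∂μ.toSphere =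
      Module.finrank ℝ E * μ.real {x | φ x < 1} := by
  have hd : (0 : ℝ) < Module.finrank ℝ E := Nat.cast_pos.2 Module.finrank_pos
  have hm : Measurable fun x : sphere (0 : E) 1 =>
      (φ x)⁻¹ ^ Module.finrank ℝ E / Module.finrank ℝ E :=
    ((hφ.comp measurable_subtype_coe).inv.pow_const _).div_const _
  rw [measureReal_def, measure_lt_one_eq_lintegral_toSphere μ hφ hhom hpos,
    ← integral_eq_lintegral_of_nonneg_ae _ hm.aestronglyMeasurable, integral_div,
    mul_div_cancel₀ _ hd.ne']
  exact Filter.Eventually.of_forall fun x => by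
    have := hpos _ x.2
    simp only [Pi.zero_apply]
    positivity

end Polar

/-! ### Star bodies are star-shaped -/

theorem IsPreconnected.inter_frontier_nonempty_of_mem_of_notMem {X : Type*} [TopologicalSpace X]
    {s t : Set X} (hs : IsPreconnected s) {x y : X} (hx : x ∈ s) (hxt : x ∈ t) (hy : y ∈ s)
    (hyt : y ∉ t) : (s ∩ frontier t).Nonempty := by
  by_contra hne
  rw [Set.not_nonempty_iff_eq_empty] at hne
  have hcover : s ⊆ interior t ∪ (closure t)ᶜ := by
    intro z hz
    by_contra hz'
    rw [Set.mem_union, not_or, Set.mem_compl_iff, not_not] at hz'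
    exact Set.notMem_empty z (hne ▸ ⟨hz, hz'.2, hz'.1⟩)
  obtain ⟨z, -, hz1, hz2⟩ := hs _ _ isOpen_interior isClosed_closure.isOpen_compl hcover
    ⟨x, hx, (hcover hx).resolve_right fun h => h (subset_closure hxt)⟩
    ⟨y, hy, (hcover hy).resolve_left fun h => hyt (interior_subset h)⟩
  exact hz2 (subset_closure (interior_subset hz1))

namespace IsStarBody

variable {n : ℕ} {D : Set (EuclideanSpace ℝ (Fin n))}

theorem exists_notMem_smul (hD : IsStarBody D) {v : EuclideanSpace ℝ (Fin n)} (hv : v ≠ 0) :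
    ∃ t : ℝ, 1 ≤ t ∧ t • v ∉ D := by
  obtain ⟨R, hR⟩ := hD.isBounded.exists_norm_le
  refine ⟨max 1 ((R + 1) / ‖v‖), le_max_left _ _, fun h => ?_⟩
  have h1 := hR _ h
  rw [norm_smul, Real.norm_of_nonneg (by positivity)] at h1
  have h2 : (R + 1) / ‖v‖ * ‖v‖ ≤ max 1 ((R + 1) / ‖v‖) * ‖v‖ := by
    gcongr; exact le_max_right _ _
  rw [div_mul_cancel₀ _ (norm_ne_zero_iff.2 hv)] at h2
  linarith

/-- Star-shapedness is forced by the count of boundary points. If `r • d` were outside, the line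
through `d` would cross the boundary at parameters in `(0, r]`, in `[1, ∞)` and below `0`: three
points instead of two. -/
theorem smul_mem (hD : IsStarBody D) {d : EuclideanSpace ℝ (Fin n)} (hd : d ∈ D) {r : ℝ}
    (hr0 : 0 < r) (hr1 : r < 1) : r • d ∈ D := by
  by_contra hrd
  have h0D : (0 : EuclideanSpace ℝ (Fin n)) ∈ D := interior_subset hD.zero_mem_interior
  have h0F : (0 : EuclideanSpace ℝ (Fin n)) ∉ frontier D := fun h => h.2 hD.zero_mem_interior
  have hd0 : d ≠ 0 := by
    rintro rfl
    exact hrd (by simpa using h0D)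
  have hcross : ∀ (I : Set ℝ) (a b : ℝ), IsPreconnected I → a ∈ I → a • d ∈ D → b ∈ I →
      b • d ∉ D → ∃ t ∈ I, t • d ∈ frontier D ∧ t ≠ 0 := by
    intro I a b hI ha haD hb hbD
    obtain ⟨_, ⟨t, ht, rfl⟩, htF⟩ := (hI.image (fun t : ℝ => t • d)
      (by fun_prop)).inter_frontier_nonempty_of_mem_of_notMem
      (Set.mem_image_of_mem _ ha) haD (Set.mem_image_of_mem _ hb) hbD
    refine ⟨t, ht, htF, ?_⟩
    rintro rfl
    exact h0F (by simpa using htF)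
  obtain ⟨b, hb1, hb⟩ := hD.exists_notMem_smul hd0
  obtain ⟨c, hc1, hc⟩ := hD.exists_notMem_smul (neg_ne_zero.2 hd0)
  obtain ⟨t₁, ht₁, hF₁, hn₁⟩ := hcross (Set.Icc 0 r) 0 r isPreconnected_Icc ⟨le_rfl, hr0.le⟩
    (by simpa using h0D) ⟨hr0.le, le_rfl⟩ hrd
  obtain ⟨t₂, ht₂, hF₂, hn₂⟩ := hcross (Set.Ici 1) 1 b isPreconnected_Ici Set.self_mem_Ici
    (by simpa using hd) hb1 hb
  obtain ⟨t₃, ht₃, hF₃, hn₃⟩ := hcross (Set.Iic 0) 0 (-c) isPreconnected_Iic Set.self_mem_Iic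
    (by simpa using h0D) (by simp only [Set.mem_Iic]; linarith) (by simpa using hc)
  have h12 : t₁ ≠ t₂ := fun h => by
    have := ht₁.2; have := Set.mem_Ici.1 ht₂; linarith
  have h13 : t₁ ≠ t₃ := fun h => by
    have := ht₁.1; have := Set.mem_Iic.1 ht₃; exact hn₁ (by linarith)
  have h23 : t₂ ≠ t₃ := fun h => by
    have := Set.mem_Ici.1 ht₂; have := Set.mem_Iic.1 ht₃; linarith
  have hinj : Function.Injective fun t : ℝ => t • d := smul_left_injective ℝ hd0
  have hcard := hD.ncard_boundary d hd0
  have hfin := Set.finite_of_ncard_ne_zero (hcard.trans_ne two_ne_zero)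
  have hsub : (fun t : ℝ => t • d) '' {t₁, t₂, t₃} ⊆
      (frontier D ∩ {x | ∃ t : ℝ, x = t • d}) \ {0} := by
    rintro _ ⟨t, ht, rfl⟩
    have : t • d ∈ frontier D ∧ t ≠ 0 := by
      rcases ht with rfl | rfl | rfl
      exacts [⟨hF₁, hn₁⟩, ⟨hF₂, hn₂⟩, ⟨hF₃, hn₃⟩]
    exact ⟨⟨this.1, t, rfl⟩, smul_ne_zero this.2 hd0⟩
  have hle := Set.ncard_le_ncard hsub hfin
  rw [Set.ncard_image_of_injective _ hinj, hcard,
    Set.ncard_eq_three.2 ⟨t₁, t₂, t₃, h12, h13, h23, rfl⟩] at hle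
  omega

theorem absorbent (hD : IsStarBody D) : Absorbent ℝ D :=
  absorbent_nhds_zero (mem_interior_iff_mem_nhds.1 hD.zero_mem_interior)

theorem gauge_pos (hD : IsStarBody D) {x : EuclideanSpace ℝ (Fin n)} (hx : x ≠ 0) :
    0 < gauge D x :=
  (_root_.gauge_pos hD.absorbent (NormedSpace.isVonNBounded_of_isBounded ℝ hD.isBounded)).2 hx

theorem setOf_gauge_lt_one_subset (hD : IsStarBody D) : {x | gauge D x < 1} ⊆ D := by
  intro x hx
  obtain ⟨r, hr0, hr1, d, hd, rfl⟩ := exists_lt_of_gauge_lt hD.absorbent hx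
  exact hD.smul_mem hd hr0 hr1

end IsStarBody

/-! ### Ball volumes and Hölder on the sphere -/

/-- The volume of the unit ball of a Euclidean space of dimension `m`. -/
noncomputable def unitBallVolume (m : ℕ) : ℝ := √Real.pi ^ m / Real.Gamma (m / 2 + 1)

theorem unitBallVolume_pos (m : ℕ) : 0 < unitBallVolume m :=
  div_pos (by positivity) (Real.Gamma_pos_of_pos (by positivity))

theorem toSphere_real_univ_eq {E : Type*} [NormedAddCommGroup E] [InnerProductSpace ℝ E]
    [FiniteDimensional ℝ E] [Nontrivial E] [MeasurableSpace E] [BorelSpace E] :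
    (volume : Measure E).toSphere.real Set.univ =
      Module.finrank ℝ E * unitBallVolume (Module.finrank ℝ E) := by
  rw [Measure.toSphere_real_apply_univ, measureReal_def, InnerProductSpace.volume_ball]
  rw [ENNReal.ofReal_one, one_pow, one_mul]
  congr 1
  exact ENNReal.toReal_ofReal (unitBallVolume_pos _).le

/-- The powers of `π` agree because `(m + 1)(1 - 1 / (m + 1)) = m`. The rest is log-convexity of
`Γ`, as `m / 2 + 1` is the combination of `(m + 1) / 2 + 1` and `1` with weight `1 / (m + 1)` on
`1`, where `Γ = 1`. -/
theorem unitBallVolume_succ_rpow_le {m : ℕ} (hm : 1 ≤ m) :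
    unitBallVolume (m + 1) ^ (1 - 1 / ((m + 1 : ℕ) : ℝ)) ≤ unitBallVolume m := by
  have hm' : (0 : ℝ) < m := by exact_mod_cast hm
  set b : ℝ := 1 / ((m + 1 : ℕ) : ℝ) with hb
  have hb0 : 0 < b := by positivity
  have hb1 : 0 < 1 - b := by
    rw [sub_pos, hb, div_lt_one (by positivity)]
    push_cast; linarith
  have hbm : ((m + 1 : ℕ) : ℝ) * (1 - b) = m := by
    rw [hb]; field_simp; push_cast; ring
  have hG : 0 < Real.Gamma (((m + 1 : ℕ) : ℝ) / 2 + 1) := Real.Gamma_pos_of_pos (by positivity)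
  have hG' : 0 < Real.Gamma ((m : ℝ) / 2 + 1) := Real.Gamma_pos_of_pos (by positivity)
  have h1 := Real.Gamma_mul_add_mul_le_rpow_Gamma_mul_rpow_Gamma
    (s := ((m + 1 : ℕ) : ℝ) / 2 + 1) (t := 1) (by positivity) one_pos hb1 hb0 (by ring)
  have e : (1 - b) * (((m + 1 : ℕ) : ℝ) / 2 + 1) + b * 1 = m / 2 + 1 := by
    rw [← hbm]; ring
  rw [e, Real.Gamma_one, Real.one_rpow, mul_one] at h1
  rw [unitBallVolume, unitBallVolume, Real.div_rpow (by positivity) hG.le,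
    ← Real.rpow_natCast, ← Real.rpow_mul (by positivity), hbm, Real.rpow_natCast]
  gcongr

/-- A positively homogeneous function satisfies `∫ φ⁻¹ ≤ d |{φ < 1}| ^ (1 / d) ω_d ^ (1 - 1 / d)`,
the integral being over the unit sphere. -/
theorem integral_toSphere_inv_le {E : Type*} [NormedAddCommGroup E] [InnerProductSpace ℝ E]
    [FiniteDimensional ℝ E] [Nontrivial E] [MeasurableSpace E] [BorelSpace E]
    (hd : 2 ≤ Module.finrank ℝ E) {φ : E → ℝ} (hφ : Continuous φ)
    (hhom : ∀ r : ℝ, 0 < r → ∀ x, φ (r • x) = r * φ x) (hpos : ∀ x ∈ sphere (0 : E) 1, 0 < φ x) :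
    ∫ x : sphere (0 : E) 1, (φ x)⁻¹ ∂(volume : Measure E).toSphere ≤
      Module.finrank ℝ E * volume.real {x | φ x < 1} ^ (1 / (Module.finrank ℝ E : ℝ)) *
        unitBallVolume (Module.finrank ℝ E) ^ (1 - 1 / (Module.finrank ℝ E : ℝ)) := by
  set d := Module.finrank ℝ E with hdd
  set σ := (volume : Measure E).toSphere
  have hd1 : (1 : ℝ) < d := by exact_mod_cast hd
  have hd0 : (0 : ℝ) < d := by linarith
  have hcont : Continuous fun x : sphere (0 : E) 1 => (φ x)⁻¹ :=
    (hφ.comp continuous_subtype_val).inv₀ fun x => (hpos _ x.2).ne'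
  have hpq : (d : ℝ).HolderConjugate ((d : ℝ).conjExponent) := .conjExponent hd1
  have hq : 1 / ((d : ℝ).conjExponent) = 1 - 1 / d := by
    have := hpq.inv_add_inv_eq_one
    rw [one_div, one_div]; linarith
  have hmem : ∀ (p : ℝ≥0∞) {u : sphere (0 : E) 1 → ℝ}, Continuous u → MemLp u p σ := fun p u hu =>
    hu.memLp_of_hasCompactSupport (HasCompactSupport.of_compactSpace _)
  -- Hölder against the constant `1` with exponent `d`, for which `∫ φ⁻¹ ^ d` is a volume.
  have key := integral_mul_le_Lp_mul_Lq_of_nonneg (μ := σ) hpq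
    (f := fun x : sphere (0 : E) 1 => (φ x)⁻¹) (g := fun _ => 1)
    (Filter.Eventually.of_forall fun x => (inv_pos.2 (hpos _ x.2)).le)
    (Filter.Eventually.of_forall fun x => zero_le_one) (hmem _ hcont) (hmem _ continuous_const)
  simp only [mul_one, Real.rpow_natCast, Real.one_rpow, integral_const, smul_eq_mul, hq] at key
  refine key.trans_eq ?_
  have hω := (unitBallVolume_pos d).le
  rw [integral_toSphere_inv_pow volume hφ.measurable hhom hpos, toSphere_real_univ_eq, ← hdd,
    Real.mul_rpow hd0.le measureReal_nonneg, Real.mul_rpow hd0.le hω]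
  have e : (d : ℝ) ^ (1 / (d : ℝ)) * (d : ℝ) ^ (1 - 1 / (d : ℝ)) = d := by
    rw [← Real.rpow_add hd0]; simp
  linear_combination (volume.real {x | φ x < 1} ^ (1 / (d : ℝ)) *
    unitBallVolume d ^ (1 - 1 / (d : ℝ))) * e

/-- A convex set has null frontier, so positive measure yields an interior point `x`; then `0` is
the midpoint of the interior points `x` and `-x`. -/
theorem zero_mem_interior_of_convex_of_symm {E : Type*} [NormedAddCommGroup E] [NormedSpace ℝ E]
    [FiniteDimensional ℝ E] [MeasurableSpace E] [BorelSpace E] (μ : Measure E)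
    [μ.IsAddHaarMeasure] {K : Set E} (hK : Convex ℝ K) (hsymm : ∀ x ∈ K, -x ∈ K)
    (hμ : μ K ≠ 0) : 0 ∈ interior K := by
  have hne : (interior K).Nonempty := by
    rw [Set.nonempty_iff_ne_empty]
    intro h
    refine hμ (measure_mono_null (t := frontier K) ?_ (hK.addHaar_frontier μ))
    rw [frontier, h, Set.sdiff_empty]
    exact subset_closure
  obtain ⟨x, hx⟩ := hne
  have hneg : -K = K := by
    ext y
    rw [Set.mem_neg]
    exact ⟨fun h => by simpa using hsymm _ h, hsymm y⟩
  have hx' : -x ∈ interior K := by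
    have h := (Homeomorph.neg E).preimage_interior K
    have h2 : (Homeomorph.neg E) ⁻¹' K = K := hneg
    rw [h2] at h
    rw [← h] at hx
    exact hx
  have := hK.interior hx hx' (a := 1 / 2) (b := 1 / 2) (by norm_num) (by norm_num) (by norm_num)
  simpa using this

theorem exists_norm_eq_one_mem_orthogonal {E : Type*} [NormedAddCommGroup E]
    [InnerProductSpace ℝ E] [FiniteDimensional ℝ E] {H : Submodule ℝ E}
    (hd : Module.finrank ℝ H < Module.finrank ℝ E) : ∃ ξ ∈ Hᗮ, ‖ξ‖ = 1 := by
  have h := H.finrank_add_finrank_orthogonal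
  have hne : Hᗮ ≠ ⊥ := by
    intro hbot
    rw [hbot, finrank_bot] at h
    omega
  obtain ⟨v, hv, hv0⟩ := Submodule.exists_mem_ne_zero_of_ne_bot hne
  exact ⟨‖v‖⁻¹ • v, Submodule.smul_mem _ _ hv, norm_smul_inv_norm hv0⟩

/-! ### Comparison of an isotropic body with an intersection body -/

section Isotropic

variable {n : ℕ} {K : Set (EuclideanSpace ℝ (Fin n))} {L : ℝ}

/-- The spherical Radon transform of `‖·‖_K ^ (-(n - 1))` for an isotropic body `K`. -/
theorem IsIsotropicWith.sphericalRadon_mul_le (hK : IsIsotropicWith K L) (hconv : Convex ℝ K)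
    (hsymm : ∀ x ∈ K, -x ∈ K) {H : Submodule ℝ (EuclideanSpace ℝ (Fin n))} {m : ℕ} (hm : 1 ≤ m)
    (hH : Module.finrank ℝ H = m) (hmn : m + 1 = n)
    {g : C(sphere (0 : EuclideanSpace ℝ (Fin n)) 1, ℝ)} (hg : ∀ x, g x = (gauge K x)⁻¹ ^ m) :
    sphericalRadon g H * L ≤ m * 400 := by
  have hint := zero_mem_interior_of_convex_of_symm volume hconv hsymm (by simp [hK.volume_eq_one])
  have hnhds : K ∈ nhds 0 := mem_interior_iff_mem_nhds.1 hint
  have habs : Absorbent ℝ K := absorbent_nhds_zero hnhds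
  have hcont := continuous_gauge hconv hnhds
  have hpos : ∀ x ≠ 0, 0 < gauge K x :=
    fun x hx => (gauge_pos habs (NormedSpace.isVonNBounded_of_isBounded ℝ hK.isCompact.isBounded)).2 hx
  have : Nontrivial H := Module.nontrivial_of_finrank_pos (R := ℝ) (by omega)
  have hR : sphericalRadon g H = m * volume.real {y : H | gauge K y < 1} := by
    have := integral_toSphere_inv_pow (volume : Measure H) (φ := fun y => gauge K y)
      (hcont.comp continuous_subtype_val).measurable
      (fun r hr y => by
        rw [Submodule.coe_smul, gauge_smul_of_nonneg hr.le, smul_eq_mul])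
      (fun y hy => hpos _ (by
        rw [ne_eq, Submodule.coe_eq_zero]
        exact ne_of_mem_sphere hy one_ne_zero))
    rw [hH] at this
    rw [← this, sphericalRadon]
    exact integral_congr_ae (Filter.Eventually.of_forall fun y => hg _)
  have hsub : {y : H | gauge K y < 1} ⊆ {y : H | (y : EuclideanSpace ℝ (Fin n)) ∈ K} := fun y hy =>
    setOfPred_gauge_lt_one_subset_self hconv (interior_subset hint) habs hy
  have hfin : volume {y : H | (y : EuclideanSpace ℝ (Fin n)) ∈ K} ≠ ∞ :=
    (IsCompact.measure_lt_top ((Submodule.closed_of_finiteDimensional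
      H).isClosedEmbedding_subtypeVal.isCompact_preimage hK.isCompact)).ne
  obtain ⟨ξ, hξH, hξ⟩ := exists_norm_eq_one_mem_orthogonal (H := H) (by
    rw [finrank_euclideanSpace_fin]; omega)
  have hsec := volume_section_mul_le hξ hξH (by rw [finrank_euclideanSpace_fin]; omega)
    hconv hK.isCompact hsymm hK.volume_eq_one hK.nonneg (hK.integral_eq ξ hξ)
  rw [hR, mul_assoc]
  refine mul_le_mul_of_nonneg_left (le_trans ?_ hsec) (Nat.cast_nonneg _)
  exact mul_le_mul_of_nonneg_right (measureReal_mono hsub hfin) hK.nonneg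

theorem sphericalRadon_one {H : Submodule ℝ (EuclideanSpace ℝ (Fin n))} {m : ℕ} (hm : 1 ≤ m)
    (hH : Module.finrank ℝ H = m) : sphericalRadon 1 H = m * unitBallVolume m := by
  have : Nontrivial H := Module.nontrivial_of_finrank_pos (R := ℝ) (by omega)
  simp [sphericalRadon, toSphere_real_univ_eq, hH, -Measure.toSphere_real_apply_univ]

theorem IsIsotropicWith.le_of_subset_intersectionBody {m : ℕ} (hm : 1 ≤ m)
    {K D : Set (EuclideanSpace ℝ (Fin (m + 1)))} (hK : IsIsotropicWith K L)
    (hconv : Convex ℝ K) (hsymm : ∀ x ∈ K, -x ∈ K) (hD : D ∈ intersectionBodies (m + 1))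
    (hKD : K ⊆ D) : L ≤ 400 * volume.real D ^ (1 / ((m + 1 : ℕ) : ℝ)) := by
  obtain ⟨hstar, -, ν, hν, hrep⟩ := hD
  set σ := (volume : Measure (EuclideanSpace ℝ (Fin (m + 1)))).toSphere
  have hfr : Module.finrank ℝ (EuclideanSpace ℝ (Fin (m + 1))) = m + 1 := finrank_euclideanSpace_fin
  have hint := zero_mem_interior_of_convex_of_symm volume hconv hsymm (by simp [hK.volume_eq_one])
  have hnhds : K ∈ nhds 0 := mem_interior_iff_mem_nhds.1 hint
  have habs : Absorbent ℝ K := absorbent_nhds_zero hnhds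
  have hcont := continuous_gauge hconv hnhds
  have hposK : ∀ x ∈ sphere (0 : EuclideanSpace ℝ (Fin (m + 1))) 1, 0 < gauge K x :=
    fun x hx => (gauge_pos habs (NormedSpace.isVonNBounded_of_isBounded ℝ hK.isCompact.isBounded)).2
      (ne_of_mem_sphere hx one_ne_zero)
  have hposD : ∀ x ∈ sphere (0 : EuclideanSpace ℝ (Fin (m + 1))) 1, 0 < gauge D x := fun x hx =>
    hstar.gauge_pos (ne_of_mem_sphere hx one_ne_zero)
  have hhom : ∀ (S : Set (EuclideanSpace ℝ (Fin (m + 1)))) (r : ℝ), 0 < r →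
      ∀ x, gauge S (r • x) = r * gauge S x :=
    fun S r hr x => by rw [gauge_smul_of_nonneg hr.le, smul_eq_mul]
  have hcK : Continuous fun x : sphere (0 : EuclideanSpace ℝ (Fin (m + 1))) 1 => (gauge K x)⁻¹ :=
    (hcont.comp continuous_subtype_val).inv₀ fun x => (hposK _ x.2).ne'
  have hcD : Continuous fun x : sphere (0 : EuclideanSpace ℝ (Fin (m + 1))) 1 => (gauge D x)⁻¹ :=
    (hstar.continuous_gauge.comp continuous_subtype_val).inv₀ fun x => (hposD _ x.2).ne'
  have hintegrable : ∀ {u : sphere (0 : EuclideanSpace ℝ (Fin (m + 1))) 1 → ℝ},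
      Continuous u → Integrable u σ := fun hu =>
    hu.integrable_of_hasCompactSupport (HasCompactSupport.of_compactSpace _)
  -- the volume of `K` in polar coordinates
  have hvolK : ∫ x : sphere (0 : EuclideanSpace ℝ (Fin (m + 1))) 1,
      (gauge K x)⁻¹ ^ (m + 1) ∂σ = (m + 1 : ℕ) := by
    have h := integral_toSphere_inv_pow
      (volume : Measure (EuclideanSpace ℝ (Fin (m + 1)))) hcont.measurable (hhom K) hposK
    rw [hfr] at h
    have hi : volume.real {x | gauge K x < 1} = 1 := by
      rw [setOfPred_gauge_lt_one_eq_interior hconv hnhds, measureReal_def,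
        measure_interior_of_null_frontier (hconv.addHaar_frontier _), hK.volume_eq_one,
        ENNReal.toReal_one]
    rw [h, hi, mul_one]
  -- The exponent `m` serves twice: one more factor gives the volume of `K`, and it is the dimension
  -- of the hyperplanes.
  let g : C(sphere (0 : EuclideanSpace ℝ (Fin (m + 1))) 1, ℝ) :=
    ⟨fun x => (gauge K x)⁻¹ ^ m, hcK.pow m⟩
  have hlower : ((m + 1 : ℕ) : ℝ) ≤ ∫ H, sphericalRadon g H.1 ∂ν := by
    rw [← hrep g, ← hvolK]
    refine integral_mono (hintegrable (hcK.pow _))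
      (hintegrable ((hcD.pow 1).mul g.continuous)) fun x => ?_
    have h1 : (gauge K x)⁻¹ ≤ (gauge D x)⁻¹ :=
      inv_anti₀ (hposD _ x.2) (gauge_mono habs hKD _)
    have h2 : 0 ≤ (gauge K x)⁻¹ := (inv_pos.2 (hposK _ x.2)).le
    change (gauge K x)⁻¹ ^ (m + 1) ≤ (gauge D x)⁻¹ ^ 1 * (gauge K x)⁻¹ ^ m
    rw [pow_succ', pow_one]
    gcongr
  have hupper : (∫ H, sphericalRadon g H.1 ∂ν) * L ≤ ν.real Set.univ * (m * 400) := by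
    rw [← integral_mul_const]
    -- A nonnegative integrand under a constant bound: no measurability in `H` has to be checked.
    have h := integral_mono_of_nonneg (μ := ν)
      (f := fun H : GrassmannianCodim (m + 1) 1 => sphericalRadon g H.1 * L)
      (g := fun _ => (m : ℝ) * 400)
      (Filter.Eventually.of_forall fun H => mul_nonneg (integral_nonneg fun x => by
        have := gauge_nonneg (s := K) (sphereIncl H.1 x : EuclideanSpace ℝ (Fin (m + 1)))
        change 0 ≤ (gauge K _)⁻¹ ^ m
        positivity) hK.nonneg) (integrable_const _)
      (Filter.Eventually.of_forall fun H => hK.sphericalRadon_mul_le hconv hsymm hm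
        (Nat.add_right_cancel H.2) rfl fun x => rfl)
    rwa [integral_const, smul_eq_mul] at h
  -- the total mass of `ν`
  have hmass : ∫ x : sphere (0 : EuclideanSpace ℝ (Fin (m + 1))) 1, (gauge D x)⁻¹ ∂σ =
      ν.real Set.univ * (m * unitBallVolume m) := by
    have h := hrep 1
    have e : ∀ H : GrassmannianCodim (m + 1) 1, sphericalRadon 1 H.1 = m * unitBallVolume m :=
      fun H => sphericalRadon_one hm (Nat.add_right_cancel H.2)
    simpa only [pow_one, ContinuousMap.one_apply, mul_one, e, integral_const, smul_eq_mul] using h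
  have hholder := integral_toSphere_inv_le (by omega) hstar.continuous_gauge (hhom D) hposD
  rw [hmass, hfr] at hholder
  have hvolD : volume.real {x | gauge D x < 1} ^ (1 / ((m + 1 : ℕ) : ℝ)) ≤
      volume.real D ^ (1 / ((m + 1 : ℕ) : ℝ)) :=
    Real.rpow_le_rpow measureReal_nonneg
      (measureReal_mono hstar.setOf_gauge_lt_one_subset hstar.isBounded.measure_lt_top.ne)
      (by positivity)
  have hω := unitBallVolume_succ_rpow_le hm
  have hω0 := unitBallVolume_pos m
  set V := volume.real D ^ (1 / ((m + 1 : ℕ) : ℝ))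
  set N : ℝ := ((m + 1 : ℕ) : ℝ)
  have hN0 : 0 < N := by positivity
  have hV0 : 0 ≤ V := by positivity
  have h1 : ν.real Set.univ * (m * unitBallVolume m) ≤ N * V * unitBallVolume m := by
    refine hholder.trans ?_
    gcongr
    exact Real.rpow_nonneg (unitBallVolume_pos _).le _
  have h2 : ν.real Set.univ * m ≤ N * V := by
    rw [← mul_assoc] at h1
    exact le_of_mul_le_mul_right h1 hω0
  -- The chain is `N L ≤ (∫ Rg dν) L ≤ 400 m ν(Gr) ≤ 400 N V`.
  have h3 : N * L ≤ N * (400 * V) := by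
    have := mul_le_mul_of_nonneg_right hlower hK.nonneg
    linarith
  exact le_of_mul_le_mul_left h3 hN0

end Isotropic

theorem mainTheorem6 :
    ∃ C : ℝ≥0, ∀ n : ℕ, 2 ≤ n →
      ∀ K : ConvexBody (EuclideanSpace ℝ (Fin n)),
        (∀ x ∈ (K : Set (EuclideanSpace ℝ (Fin n))),
          -x ∈ (K : Set (EuclideanSpace ℝ (Fin n)))) →
        ∀ L : ℝ, IsIsotropicWith (K : Set (EuclideanSpace ℝ (Fin n))) L →
          ENNReal.ofReal L ≤
            C * outerVolumeRatioDist (K : Set (EuclideanSpace ℝ (Fin n)))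
              (intersectionBodies n) := by
  refine ⟨400, fun n hn K hsymm L hL => ?_⟩
  obtain ⟨m, rfl⟩ : ∃ m, n = m + 1 := ⟨n - 1, by omega⟩
  -- A finite nonzero factor passes through each infimum, so one admissible `D` at a time suffices.
  rw [outerVolumeRatioDist, ENNReal.mul_iInf_of_ne (by norm_num) ENNReal.coe_ne_top]
  refine le_iInf fun D => ?_
  rw [ENNReal.mul_iInf_of_ne (by norm_num) ENNReal.coe_ne_top]
  refine le_iInf fun hD => ?_
  rw [ENNReal.mul_iInf_of_ne (by norm_num) ENNReal.coe_ne_top]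
  refine le_iInf fun hKD => ?_
  have h := hL.le_of_subset_intersectionBody (by omega) K.convex hsymm hD hKD
  rw [hL.volume_eq_one, div_one, ← ENNReal.ofReal_toReal hD.1.isBounded.measure_lt_top.ne,
    ENNReal.ofReal_rpow_of_nonneg ENNReal.toReal_nonneg (by positivity)]
  refine (ENNReal.ofReal_le_ofReal h).trans_eq ?_
  rw [ENNReal.ofReal_mul (by norm_num)]
  norm_num [measureReal_def]
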